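/- Let $k$ be a number field. For nonzero $n\in k[t]$ of degree $|n|$ write $n\succ 0$ ($n$ is positive) if the leading coefficient of $(-1)^{|n|}n$ is a nonzero square in $k$, and say that $n$ is negative if $-n\succ0$. Let $D\in k[t]$ be negative and square-free, of odd degree. Let $\mathcal Q_D$ be the set of binary quadratic forms $Q=(a,b,c)=ax^2+2bxy+cy^2$ with $a,b,c\in k[t]$, $b^2-ac=D$ and $a\succ 0$, and let $\mathcal C_D$ be the set of its $\mathrm{SL}_2(k[t])$-equivalence classes. $\mathcal C_D$ is an abelian group under composition: the product of $C$ and $C'$ is the class of $(aa',e,f)$ whenever $(a,e,a'f)\in C$ and $(a',e,af)\in C'$; the identity is the class of $(1,0,-D)$, and the inverse of the class of $(a,b,c)$ is the class of $(a,-b,c)$. For a monic irreducible polynomial $p$ let $F_p=k[t]/(p)$ and, for $x,y\in k(t)^\times$, let $$(x,y)_p=(-1)^{v_p(x)v_p(y)}\,\bar x_0^{\,v_p(y)}\,\bar y_0^{\,v_p(x)}\in F_p^{\times}/F_p^{\times 2},$$ where $x=p^{v_p(x)}x_0$ and $y=p^{v_p(y)}y_0$ with $x_0,y_0$ prime to $p$,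 and the bar denotes reduction modulo $p$. The genus character $\chi_p:\mathcal C_D\to F_p^\times/F_p^{\times2}$ is the homomorphism sending the class of $Q$ to $(n,D)_p$, where $n$ is any polynomial prime to $p$ of the form $n=Q(x,y)$ with $x,y\in k[t]$ coprime. The principal genus is $\bigcap_{p\mid D}\ker\chi_p$, over all monic irreducible $p\mid D$, and the group of genera $\mathcal G_D$ is the group of its cosets in $\mathcal C_D$. Then the principal genus is equal to $\mathcal C_D^2=\{C^2: C\in\mathcal C_D\}$. Hence $\mathcal G_D=\mathcal C_D/\mathcal C_D^2$, that is, the identity map of $\mathcal C_D$ induces an isomorphism of groups $\mathcal G_D\to\mathcal C_D/\mathcal C_D^2$. -/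

import Mathlib

open Polynomial

namespace PolyQuad

noncomputable section

/-! ### Signs of polynomials -/

/-- `n ≻ 0`: the leading coefficient of `n^* = (-1)^{deg n} n` is a nonzero square of `k`. -/
def IsPositive {k : Type*} [Field k] (n : k[X]) : Prop :=
  ∃ c : k, c ≠ 0 ∧ ((-1) ^ n.natDegree * n).leadingCoeff = c ^ 2

/-- `n ≺ 0`: `-n ≻ 0`. -/
def IsNegative {k : Type*} [Field k] (n : k[X]) : Prop := IsPositive (-n)

/-- The discriminants under consideration: negative, square-free, of odd degree. -/
class NegSqfreeOdd {k : Type*} [Field k] (D : k[X]) : Prop where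
  neg : IsNegative D
  sqfree : Squarefree D
  odd : Odd D.natDegree

/-! ### Binary quadratic forms -/

/-- The form `(a, b, c) = a x² + 2 b x y + c y²`. -/
@[ext]
structure BinForm (k : Type*) [Field k] where
  a : k[X]
  b : k[X]
  c : k[X]

namespace BinForm

variable {k : Type*} [Field k]

/-- The value `Q(x, y)`. -/
def eval (Q : BinForm k) (x y : k[X]) : k[X] := Q.a * x ^ 2 + 2 * Q.b * x * y + Q.c * y ^ 2

/-- The discriminant (Gaussian determinant) `b² - a c`. -/
def disc (Q : BinForm k) : k[X] := Q.b ^ 2 - Q.a * Q.c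

/-- `Q | M`, so that `(Q | M)(x, y) = Q(m x + r y, n x + s y)` for `M = (m r; n s)`. -/
def act (Q : BinForm k) (M : Matrix.SpecialLinearGroup (Fin 2) k[X]) : BinForm k where
  a := Q.a * M 0 0 ^ 2 + 2 * Q.b * M 0 0 * M 1 0 + Q.c * M 1 0 ^ 2
  b := Q.a * M 0 0 * M 0 1 + Q.b * (M 0 0 * M 1 1 + M 0 1 * M 1 0) + Q.c * M 1 0 * M 1 1
  c := Q.a * M 0 1 ^ 2 + 2 * Q.b * M 0 1 * M 1 1 + Q.c * M 1 1 ^ 2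

/-- `n` is properly represented by `Q`: `n = Q(x, y)` with `x, y` coprime. -/
def ProperlyRepresents (Q : BinForm k) (n : k[X]) : Prop :=
  ∃ x y : k[X], IsCoprime x y ∧ Q.eval x y = n

theorem act_one (Q : BinForm k) : Q.act 1 = Q := by
  ext1 <;> simp [act]

theorem act_mul (Q : BinForm k) (M N : Matrix.SpecialLinearGroup (Fin 2) k[X]) :
    (Q.act M).act N = Q.act (M * N) := by
  ext1 <;> simp only [act, Matrix.SpecialLinearGroup.coe_mul, Matrix.mul_apply,
    Fin.sum_univ_two] <;> ring

end BinForm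

/-- The set `𝒬_D` of forms of discriminant `D` with `a ≻ 0`. -/
@[ext]
structure Form {k : Type*} [Field k] (D : k[X]) extends BinForm k where
  disc_eq : toBinForm.disc = D
  pos : IsPositive toBinForm.a

section Classes

variable {k : Type*} [Field k] {D : k[X]}

/-- `SL₂(k[t])`-equivalence on `𝒬_D`. -/
instance formSetoid (D : k[X]) : Setoid (Form D) where
  r Q Q' := ∃ M : Matrix.SpecialLinearGroup (Fin 2) k[X], Q'.toBinForm = Q.toBinForm.act M
  iseqv := by
    refine ⟨fun Q => ⟨1, (BinForm.act_one _).symm⟩, ?_, ?_⟩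
    · rintro Q Q' ⟨M, h⟩
      exact ⟨M⁻¹, by rw [h, BinForm.act_mul, mul_inv_cancel, BinForm.act_one]⟩
    · rintro Q Q' Q'' ⟨M, h⟩ ⟨N, h'⟩
      exact ⟨M * N, by rw [h', h, BinForm.act_mul]⟩

/-- The set `𝒞_D` of classes of forms. -/
def FormClass (D : k[X]) : Type _ := Quotient (formSetoid D)

/-- The class of a form. -/
def cls (Q : Form D) : FormClass D := Quotient.mk _ Q

/-- Dirichlet composition: `C''` is the class of `(a a', e, f)`, where `(a, e, a' f) ∈ C` and
`(a', e, a f) ∈ C'`. -/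
def Composes (C C' C'' : FormClass D) : Prop :=
  ∃ (Q Q' Q'' : Form D) (a a' e f : k[X]),
    Q.toBinForm = ⟨a, e, a' * f⟩ ∧ Q'.toBinForm = ⟨a', e, a * f⟩ ∧
    Q''.toBinForm = ⟨a * a', e, f⟩ ∧ cls Q = C ∧ cls Q' = C' ∧ cls Q'' = C''

/-! ### Facts on signs -/

theorem isPositive_iff {n : k[X]} :
    IsPositive n ↔ ∃ c : k, c ≠ 0 ∧ (-1) ^ n.natDegree * n.leadingCoeff = c ^ 2 := by
  have : ((-1) ^ n.natDegree * n).leadingCoeff = (-1) ^ n.natDegree * n.leadingCoeff := by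
    rw [leadingCoeff_mul, leadingCoeff_pow, leadingCoeff_neg, leadingCoeff_one]
  unfold IsPositive
  rw [this]

theorem IsPositive.ne_zero {n : k[X]} (h : IsPositive n) : n ≠ 0 := by
  obtain ⟨c, hc, h⟩ := isPositive_iff.1 h
  rintro rfl
  rw [leadingCoeff_zero, mul_zero] at h
  exact hc (pow_eq_zero_iff (two_ne_zero)|>.1 h.symm)

theorem IsPositive.mul {m n : k[X]} (hm : IsPositive m) (hn : IsPositive n) :
    IsPositive (m * n) := by
  have hm0 := hm.ne_zero
  have hn0 := hn.ne_zero
  rw [isPositive_iff] at *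
  obtain ⟨c, hc, h⟩ := hm
  obtain ⟨d, hd, h'⟩ := hn
  refine ⟨c * d, mul_ne_zero hc hd, ?_⟩
  rw [natDegree_mul hm0 hn0, leadingCoeff_mul, mul_pow, ← h, ← h']
  ring

theorem IsPositive.of_mul {m n : k[X]} (hmn : IsPositive (m * n)) (hm : IsPositive m) :
    IsPositive n := by
  have hm0 := hm.ne_zero
  have hn0 : n ≠ 0 := fun h => hmn.ne_zero (by rw [h, mul_zero])
  rw [isPositive_iff] at *
  obtain ⟨c, hc, h⟩ := hm
  obtain ⟨d, hd, h'⟩ := hmn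
  refine ⟨d / c, div_ne_zero hd hc, ?_⟩
  rw [natDegree_mul hm0 hn0, leadingCoeff_mul] at h'
  rw [div_pow, ← h, ← h', eq_div_iff (by rw [h]; exact pow_ne_zero _ hc)]
  ring

theorem isPositive_one : IsPositive (1 : k[X]) :=
  isPositive_iff.2 ⟨1, one_ne_zero, by simp⟩

theorem isPositive_sq {n : k[X]} (h : n ≠ 0) : IsPositive (n ^ 2) :=
  isPositive_iff.2 ⟨n.leadingCoeff, leadingCoeff_ne_zero.2 h, by
    rw [natDegree_pow, leadingCoeff_pow, pow_mul]; simp⟩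

theorem exists_sq_of_isPositive_C {d : k} (h : IsPositive (C d)) : ∃ c : k, c ≠ 0 ∧ d = c ^ 2 := by
  simpa using isPositive_iff.1 h

theorem IsPositive.add_of_degree_lt {m n : k[X]} (hm : IsPositive m)
    (h : n.degree < m.degree) : IsPositive (m + n) := by
  rw [isPositive_iff] at *
  rwa [natDegree_eq_of_degree_eq (degree_add_eq_left_of_degree_lt h),
    leadingCoeff_add_of_degree_lt' h]

theorem Form.bb (Q : Form D) : Q.b ^ 2 - Q.a * Q.c = D := Q.disc_eq

variable [hD : NegSqfreeOdd D]

theorem disc_ne_zero (D : k[X]) [hD : NegSqfreeOdd D] : D ≠ 0 := hD.sqfree.ne_zero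

/-- The norm form is positive. -/
theorem isPositive_norm {x y : k[X]} (h : ¬ (x = 0 ∧ y = 0)) : IsPositive (x ^ 2 - D * y ^ 2) := by
  have hDn : IsPositive (-D) := hD.neg
  by_cases hy : y = 0
  · subst hy
    simpa using isPositive_sq (n := x) (fun hx => h ⟨hx, rfl⟩)
  have h2 : IsPositive (-D * y ^ 2) := hDn.mul (isPositive_sq hy)
  by_cases hx : x = 0
  · subst hx
    simpa using h2
  have h1 : IsPositive (x ^ 2) := isPositive_sq hx
  have hne : (x ^ 2).natDegree ≠ (-D * y ^ 2).natDegree := by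
    rw [natDegree_mul hDn.ne_zero (pow_ne_zero _ hy), natDegree_pow, natDegree_pow, natDegree_neg]
    obtain ⟨r, hr⟩ := hD.odd
    omega
  rcases lt_or_gt_of_ne hne with hlt | hlt
  · have := h2.add_of_degree_lt (degree_lt_degree hlt)
    rwa [show x ^ 2 - D * y ^ 2 = -D * y ^ 2 + x ^ 2 by ring]
  · have := h1.add_of_degree_lt (degree_lt_degree hlt)
    rwa [show x ^ 2 - D * y ^ 2 = x ^ 2 + -D * y ^ 2 by ring]

theorem BinForm.a_mul_eval (Q : BinForm k) (x y : k[X]) :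
    Q.a * Q.eval x y = (Q.a * x + Q.b * y) ^ 2 - Q.disc * y ^ 2 := by
  unfold BinForm.eval BinForm.disc; ring

/-- Values of forms in `𝒬_D` are positive. -/
theorem Form.isPositive_eval (Q : Form D) {x y : k[X]} (h : ¬ (x = 0 ∧ y = 0)) :
    IsPositive (Q.eval x y) := by
  refine IsPositive.of_mul (m := Q.a) ?_ Q.pos
  rw [BinForm.a_mul_eval, Q.disc_eq]
  refine isPositive_norm ?_
  rintro ⟨h1, rfl⟩
  rw [mul_zero, add_zero, mul_eq_zero] at h1
  exact h ⟨h1.resolve_left Q.pos.ne_zero, rfl⟩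

theorem BinForm.disc_act (Q : BinForm k) (M : Matrix.SpecialLinearGroup (Fin 2) k[X]) :
    (Q.act M).disc = Q.disc := by
  have h := M.det_coe
  rw [Matrix.det_fin_two] at h
  calc (Q.act M).disc = (M 0 0 * M 1 1 - M 0 1 * M 1 0) ^ 2 * Q.disc := by
        unfold BinForm.disc BinForm.act; ring
    _ = Q.disc := by rw [h]; ring

theorem sl_col_ne (M : Matrix.SpecialLinearGroup (Fin 2) k[X]) : ¬ (M 0 0 = 0 ∧ M 1 0 = 0) := by
  rintro ⟨h1, h2⟩
  have h := M.det_coe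
  rw [Matrix.det_fin_two, h1, h2] at h
  simp at h

/-- The action of `SL₂(k[t])` preserves `𝒬_D`. -/
def Form.act (Q : Form D) (M : Matrix.SpecialLinearGroup (Fin 2) k[X]) : Form D where
  toBinForm := Q.toBinForm.act M
  disc_eq := by rw [BinForm.disc_act, Q.disc_eq]
  pos := Q.isPositive_eval (sl_col_ne M)

theorem cls_act (Q : Form D) (M : Matrix.SpecialLinearGroup (Fin 2) k[X]) :
    cls (Q.act M) = cls Q := (Quotient.sound ⟨M, rfl⟩ : cls Q = cls (Q.act M)).symm

/-- The principal form `(1, 0, -D)`. -/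
def principalForm (D : k[X]) : Form D where
  toBinForm := ⟨1, 0, -D⟩
  disc_eq := by simp [BinForm.disc]
  pos := isPositive_one

/-- The opposite form `(a, -b, c)`. -/
def Form.opp (Q : Form D) : Form D where
  toBinForm := ⟨Q.a, -Q.b, Q.c⟩
  disc_eq := by simpa [BinForm.disc] using Q.disc_eq
  pos := Q.pos

/-! ### Facts on primitivity and represented values -/

theorem not_prime_sq_dvd {p : k[X]} (hp : Prime p) (h : p ^ 2 ∣ D) : False := by
  rw [pow_two] at h
  exact hp.not_isUnit (hD.sqfree p h)

theorem isUnit_two [CharZero k] : IsUnit (2 : k[X]) := by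
  rw [show (2 : k[X]) = C 2 by rfl, isUnit_C]
  exact isUnit_iff_ne_zero.2 two_ne_zero

theorem prime_dvd_of_two_mul [CharZero k] {p b : k[X]} (hp : Prime p) (h : p ∣ 2 * b) : p ∣ b :=
  (hp.dvd_or_dvd h).resolve_left fun h2 => hp.not_isUnit (isUnit_of_dvd_unit h2 isUnit_two)

theorem exists_bezout {a b c : k[X]} (hc : c ≠ 0) (h : ∀ p, Prime p → p ∣ a → p ∣ b → p ∣ c → False) :
    ∃ x y z : k[X], x * a + y * b + z * c = 1 := by
  classical
  have : IsCoprime (EuclideanDomain.gcd a b) c := by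
    refine isCoprime_of_prime_dvd (fun h => hc h.2) fun p hp h1 h2 => ?_
    exact h p hp (h1.trans (EuclideanDomain.gcd_dvd_left a b))
      (h1.trans (EuclideanDomain.gcd_dvd_right a b)) h2
  obtain ⟨u, v, huv⟩ := this
  refine ⟨u * EuclideanDomain.gcdA a b, u * EuclideanDomain.gcdB a b, v, ?_⟩
  rw [← huv, EuclideanDomain.gcd_eq_gcd_ab a b]
  ring

theorem finite_bad [CharZero k] (Q : Form D) {p : k[X]} (hp : Prime p) :
    {x : k | p ∣ Q.eval (C x) 1}.Finite := by
  classical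
  have : Fact (Irreducible p) := ⟨hp.irreducible⟩
  let φ := AdjoinRoot.mk p
  let G : (AdjoinRoot p)[X] := C (φ Q.a) * X ^ 2 + C (φ (2 * Q.b)) * X + C (φ Q.c)
  have hG : G ≠ 0 := by
    intro h
    have h0 : φ Q.c = 0 := by simpa [G] using congrArg (fun P => coeff P 0) h
    have h1 : φ (2 * Q.b) = 0 := by
      simpa [G, coeff_X, coeff_C, coeff_X_pow] using congrArg (fun P => coeff P 1) h
    have h2 : φ Q.a = 0 := by
      simpa [G, coeff_X, coeff_C, coeff_X_pow] using congrArg (fun P => coeff P 2) h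
    rw [AdjoinRoot.mk_eq_zero] at h0 h1 h2
    have hb := prime_dvd_of_two_mul hp h1
    refine not_prime_sq_dvd (D := D) hp ?_
    rw [← Q.bb]
    refine dvd_sub (pow_dvd_pow_of_dvd hb 2) ?_
    rw [pow_two]
    exact mul_dvd_mul h2 h0
  have hfin : ((AdjoinRoot.of p) ⁻¹' (G.roots.toFinset : Set (AdjoinRoot p))).Finite :=
    (Finset.finite_toSet _).preimage (AdjoinRoot.of p).injective.injOn
  refine hfin.subset ?_
  intro x hx
  simp only [Set.mem_ofPred_eq] at hx
  rw [← AdjoinRoot.mk_eq_zero] at hx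
  simp only [Set.mem_preimage, Finset.mem_coe, Multiset.mem_toFinset, mem_roots hG, IsRoot.def]
  rw [← hx]
  simp only [G, φ, BinForm.eval, eval_add, eval_mul, eval_C, eval_pow, eval_X, map_add, map_mul,
    map_pow, map_one, AdjoinRoot.mk_C]
  ring

/-- Every class contains a form whose first coefficient is prime to a given polynomial. -/
theorem exists_rep [CharZero k] (Q : Form D) {f : k[X]} (hf : f ≠ 0) :
    ∃ Q' : Form D, cls Q' = cls Q ∧ IsCoprime Q'.a f := by
  classical
  have hfin : (⋃ p ∈ (UniqueFactorizationMonoid.normalizedFactors f).toFinset,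
      {x : k | p ∣ Q.eval (C x) 1}).Finite := by
    refine Set.Finite.biUnion (Finset.finite_toSet _) fun p hp => ?_
    exact finite_bad Q (UniqueFactorizationMonoid.prime_of_normalized_factor p (Multiset.mem_toFinset.1 hp))
  obtain ⟨x, hx⟩ := hfin.exists_notMem
  let M : Matrix.SpecialLinearGroup (Fin 2) k[X] :=
    ⟨!![C x, -1; 1, 0], by rw [Matrix.det_fin_two]; simp⟩
  refine ⟨Q.act M, cls_act Q M, ?_⟩
  have ha : (Q.act M).a = Q.eval (C x) 1 := rfl
  refine isCoprime_of_prime_dvd (fun h => hf h.2) fun p hp h1 h2 => hx ?_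
  obtain ⟨q, hq, hpq⟩ :=
    UniqueFactorizationMonoid.exists_mem_normalizedFactors_of_dvd hf hp.irreducible h2
  simp only [Set.mem_iUnion, Multiset.mem_toFinset, Set.mem_ofPred_eq]
  exact ⟨q, hq, hpq.symm.dvd.trans (ha ▸ h1)⟩

theorem translate (Q : Form D) {e c : k[X]} (h : Q.a ∣ e - Q.b) (hc : e ^ 2 - Q.a * c = D) :
    ∃ Q' : Form D, cls Q' = cls Q ∧ Q'.toBinForm = ⟨Q.a, e, c⟩ := by
  obtain ⟨n, hn⟩ := h
  let M : Matrix.SpecialLinearGroup (Fin 2) k[X] :=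
    ⟨!![1, n; 0, 1], by rw [Matrix.det_fin_two]; simp⟩
  have he : e = Q.b + n * Q.a := by linear_combination hn
  refine ⟨Q.act M, cls_act Q M, ?_⟩
  have hac : Q.a * (Q.a * n ^ 2 + 2 * Q.b * n + Q.c) = Q.a * c := by
    have := Q.bb
    subst he
    linear_combination hc - this
  have := mul_left_cancel₀ Q.pos.ne_zero hac
  ext1
  · simp [Form.act, BinForm.act, M]
  · simp [Form.act, BinForm.act, M, he]; ring
  · simpa [Form.act, BinForm.act, M] using this

theorem exists_composes_coprime [CharZero k] (C C' : FormClass D) {f : k[X]} (hf : f ≠ 0) :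
    ∃ (Q Q' Q'' : Form D) (a a' e g : k[X]),
      Q.toBinForm = ⟨a, e, a' * g⟩ ∧ Q'.toBinForm = ⟨a', e, a * g⟩ ∧
      Q''.toBinForm = ⟨a * a', e, g⟩ ∧ cls Q = C ∧ cls Q' = C' ∧
      IsCoprime a f ∧ IsCoprime a' f := by
  induction C using Quotient.inductionOn with | _ R
  induction C' using Quotient.inductionOn with | _ R'
  obtain ⟨Q, hQ, hQf⟩ := exists_rep R hf
  obtain ⟨Q', hQ', hQf'⟩ := exists_rep R' (mul_ne_zero Q.pos.ne_zero hf)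
  have hcop : IsCoprime Q'.a Q.a := hQf'.of_mul_right_left
  obtain ⟨u, v, huv⟩ := hcop
  set e := Q.b + v * Q.a * (Q'.b - Q.b) with he
  have h1 : Q.a ∣ e - Q.b := ⟨v * (Q'.b - Q.b), by rw [he]; ring⟩
  have h2 : Q'.a ∣ e - Q'.b := ⟨-u * (Q'.b - Q.b), by
    rw [he]; linear_combination (Q'.b - Q.b) * huv⟩
  have d1 : Q.a ∣ e ^ 2 - D := by
    have : e ^ 2 - D = (e - Q.b) * (e + Q.b) + Q.a * Q.c := by linear_combination Q.bb
    rw [this]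
    exact dvd_add (h1.mul_right _) (dvd_mul_right _ _)
  have d2 : Q'.a ∣ e ^ 2 - D := by
    have : e ^ 2 - D = (e - Q'.b) * (e + Q'.b) + Q'.a * Q'.c := by linear_combination Q'.bb
    rw [this]
    exact dvd_add (h2.mul_right _) (dvd_mul_right _ _)
  obtain ⟨g, hg⟩ := IsCoprime.mul_dvd (show IsCoprime Q.a Q'.a from ⟨v, u, by rw [add_comm, huv]⟩) d1 d2
  obtain ⟨P, hP, hP'⟩ := translate Q h1 (c := Q'.a * g) (by linear_combination hg)
  obtain ⟨P', hp, hp'⟩ := translate Q' h2 (c := Q.a * g) (by linear_combination hg)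
  exact ⟨P, P', ⟨⟨Q.a * Q'.a, e, g⟩, by simp only [BinForm.disc]; linear_combination hg,
    Q.pos.mul Q'.pos⟩, Q.a, Q'.a, e, g, hP', hp', rfl, hP.trans hQ, hp.trans hQ', hQf,
    hQf'.of_mul_right_right⟩

/-- Any two classes can be composed. -/
theorem exists_composes [CharZero k] (C C' : FormClass D) : ∃ C'', Composes C C' C'' := by
  obtain ⟨Q, Q', Q'', a, a', e, g, h1, h2, h3, h4, h5, -⟩ :=
    exists_composes_coprime C C' one_ne_zero
  exact ⟨cls Q'', Q, Q', Q'', a, a', e, g, h1, h2, h3, h4, h5, rfl⟩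

/-! ### Lattices attached to forms, used to prove that composition is well defined -/

/-- The ring `k[t][√D]`. -/
abbrev Ord (D : k[X]) := QuadraticAlgebra k[X] D 0

instance : NoZeroDivisors (Ord D) where
  eq_zero_or_eq_zero_of_mul_eq_zero := by
    intro z w h
    by_contra! hc
    have hz : ¬ (z.re = 0 ∧ z.im = 0) := fun h' => hc.1 (QuadraticAlgebra.ext h'.1 h'.2)
    have hw : ¬ (w.re = 0 ∧ w.im = 0) := fun h' => hc.2 (QuadraticAlgebra.ext h'.1 h'.2)
    refine (mul_ne_zero (isPositive_norm (D := D) hz).ne_zero (isPositive_norm (D := D) hw).ne_zero) ?_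
    have h1 := congrArg QuadraticAlgebra.re h
    have h2 := congrArg QuadraticAlgebra.im h
    simp only [QuadraticAlgebra.re_mul, QuadraticAlgebra.im_mul, QuadraticAlgebra.re_zero,
      QuadraticAlgebra.im_zero] at h1 h2
    have h3 : z.re * w.im + z.im * w.re = 0 := by linear_combination h2
    linear_combination (z.re * w.re + D * z.im * w.im) * h1 - D * (z.re * w.im + z.im * w.re) * h3

/-- The ideal `(a, b + √D)`. -/
def idl (Q : Form D) : Ideal (Ord D) := Ideal.span {⟨Q.a, 0⟩, ⟨Q.b, 1⟩}

theorem mem_idl {Q : Form D} {z : Ord D} :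
    z ∈ idl Q ↔ ∃ u v : k[X], z = ⟨u * Q.a + v * Q.b, v⟩ := by
  unfold idl
  rw [Ideal.mem_span_pair]
  have hb := Q.bb
  constructor
  · rintro ⟨s, t, rfl⟩
    refine ⟨s.re - s.im * Q.b + t.re * 0 - t.im * Q.c, s.im * Q.a + t.re + t.im * Q.b, ?_⟩
    ext1 <;> simp only [QuadraticAlgebra.re_mul, QuadraticAlgebra.im_mul, QuadraticAlgebra.re_add,
      QuadraticAlgebra.im_add]
    · linear_combination -t.im * hb
    · ring
  · rintro ⟨u, v, rfl⟩
    refine ⟨⟨u, 0⟩, ⟨v, 0⟩, ?_⟩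
    ext1 <;> simp

theorem mem_mul_idl {Q : Form D} {x z : Ord D} :
    z ∈ Ideal.span {x} * idl Q ↔ ∃ u v : k[X], z = x * ⟨u * Q.a + v * Q.b, v⟩ := by
  rw [Ideal.mem_span_singleton_mul]
  constructor
  · rintro ⟨w, hw, rfl⟩
    obtain ⟨u, v, rfl⟩ := mem_idl.1 hw
    exact ⟨u, v, rfl⟩
  · rintro ⟨u, v, rfl⟩
    exact ⟨_, mem_idl.2 ⟨u, v, rfl⟩, rfl⟩

/-- Two ideals differ by a nonzero scalar of the fraction field. -/
def IdEq (I J : Ideal (Ord D)) : Prop :=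
  ∃ x y : Ord D, x ≠ 0 ∧ y ≠ 0 ∧ Ideal.span {x} * I = Ideal.span {y} * J

theorem IdEq.of_eq {I J : Ideal (Ord D)} (h : I = J) : IdEq I J := ⟨1, 1, one_ne_zero, one_ne_zero, by rw [h]⟩

theorem IdEq.symm {I J : Ideal (Ord D)} (h : IdEq I J) : IdEq J I := by
  obtain ⟨x, y, hx, hy, h⟩ := h
  exact ⟨y, x, hy, hx, h.symm⟩

theorem IdEq.trans {I J K : Ideal (Ord D)} (h : IdEq I J) (h' : IdEq J K) : IdEq I K := by
  obtain ⟨x, y, hx, hy, h⟩ := h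
  obtain ⟨z, w, hz, hw, h'⟩ := h'
  refine ⟨z * x, y * w, mul_ne_zero hz hx, mul_ne_zero hy hw, ?_⟩
  rw [← Ideal.span_singleton_mul_span_singleton, ← Ideal.span_singleton_mul_span_singleton,
    mul_assoc, h, mul_left_comm, h', mul_assoc]

theorem IdEq.mul {I J K L : Ideal (Ord D)} (h : IdEq I J) (h' : IdEq K L) :
    IdEq (I * K) (J * L) := by
  obtain ⟨x, y, hx, hy, h⟩ := h
  obtain ⟨z, w, hz, hw, h'⟩ := h'
  refine ⟨x * z, y * w, mul_ne_zero hx hz, mul_ne_zero hy hw, ?_⟩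
  rw [← Ideal.span_singleton_mul_span_singleton, ← Ideal.span_singleton_mul_span_singleton,
    mul_mul_mul_comm, h, h', mul_mul_mul_comm]

theorem idEq_of_cls_eq {Q Q' : Form D} (h : cls Q = cls Q') : IdEq (idl Q) (idl Q') := by
  obtain ⟨M, hM⟩ : ∃ M : Matrix.SpecialLinearGroup (Fin 2) k[X],
    Q'.toBinForm = Q.toBinForm.act M := Quotient.exact h
  have hdet := M.det_coe
  rw [Matrix.det_fin_two] at hdet
  have ha : Q'.a = Q.a * M 0 0 ^ 2 + 2 * Q.b * M 0 0 * M 1 0 + Q.c * M 1 0 ^ 2 := by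
    rw [hM]; rfl
  have hb : Q'.b = Q.a * M 0 0 * M 0 1 + Q.b * (M 0 0 * M 1 1 + M 0 1 * M 1 0)
      + Q.c * M 1 0 * M 1 1 := by rw [hM]; rfl
  have hq := Q.bb
  generalize M 0 0 = m at *
  generalize M 0 1 = r at *
  generalize M 1 0 = n at *
  generalize M 1 1 = s at *
  have key : ∀ u v : k[X], (⟨Q.a * m + Q.b * n, -n⟩ : Ord D) *
      ⟨(u * m + v * r) * Q.a + (u * n + v * s) * Q.b, u * n + v * s⟩ =
      ⟨Q.a, 0⟩ * ⟨u * Q'.a + v * Q'.b, v⟩ := by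
    intro u v
    ext1 <;> simp only [QuadraticAlgebra.re_mul, QuadraticAlgebra.im_mul]
    · rw [ha, hb]
      linear_combination (n * (u * n + v * s)) * hq
    · linear_combination (Q.a * v) * hdet
  refine ⟨⟨Q.a * m + Q.b * n, -n⟩, ⟨Q.a, 0⟩, ?_, ?_, ?_⟩
  · intro h0
    have h1 : Q.a * m + Q.b * n = 0 := congrArg QuadraticAlgebra.re h0
    have h2 : -n = 0 := congrArg QuadraticAlgebra.im h0
    have hn : n = 0 := neg_eq_zero.1 h2
    subst hn
    rw [mul_zero, add_zero, mul_eq_zero] at h1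
    rw [h1.resolve_left Q.pos.ne_zero] at hdet
    simp at hdet
  · intro h0
    exact Q.pos.ne_zero (congrArg QuadraticAlgebra.re h0)
  · ext z
    rw [mem_mul_idl, mem_mul_idl]
    constructor
    · rintro ⟨u, v, rfl⟩
      refine ⟨s * u - r * v, m * v - n * u, ?_⟩
      rw [← key]
      congr 1
      ext1 <;> simp only
      · linear_combination (-(u * Q.a + v * Q.b)) * hdet
      · linear_combination (-v) * hdet
    · rintro ⟨u, v, rfl⟩
      exact ⟨_, _, (key u v).symm⟩

theorem cls_eq_of_idEq {Q Q' : Form D} (h : IdEq (idl Q) (idl Q')) : cls Q = cls Q' := by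
  obtain ⟨x, y, hx, hy, h⟩ := h
  have g1 : y * ⟨Q'.a, 0⟩ ∈ Ideal.span {x} * idl Q := by
    rw [h, mem_mul_idl]; exact ⟨1, 0, by simp⟩
  have g2 : y * ⟨Q'.b, 1⟩ ∈ Ideal.span {x} * idl Q := by
    rw [h, mem_mul_idl]; exact ⟨0, 1, by simp⟩
  have g3 : x * ⟨Q.a, 0⟩ ∈ Ideal.span {y} * idl Q' := by
    rw [← h, mem_mul_idl]; exact ⟨1, 0, by simp⟩
  have g4 : x * ⟨Q.b, 1⟩ ∈ Ideal.span {y} * idl Q' := by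
    rw [← h, mem_mul_idl]; exact ⟨0, 1, by simp⟩
  obtain ⟨m, n, g1⟩ := mem_mul_idl.1 g1
  obtain ⟨r, s, g2⟩ := mem_mul_idl.1 g2
  obtain ⟨m', n', g3⟩ := mem_mul_idl.1 g3
  obtain ⟨r', s', g4⟩ := mem_mul_idl.1 g4
  have hq := Q.bb
  have hq' := Q'.bb
  have ha := Q.pos.ne_zero
  have ha' := Q'.pos.ne_zero
  -- the transition matrix is invertible
  have e3 : (⟨Q.a, 0⟩ : Ord D) = ⟨m', 0⟩ * ⟨m * Q.a + n * Q.b, n⟩ + ⟨n', 0⟩ * ⟨r * Q.a + s * Q.b, s⟩ := by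
    apply mul_left_cancel₀ hx
    rw [mul_add, mul_left_comm x, mul_left_comm x, ← g1, ← g2, g3, mul_left_comm, mul_left_comm _ y,
      ← mul_add]
    congr 1
    ext1 <;> simp
  have e4 : (⟨Q.b, 1⟩ : Ord D) = ⟨r', 0⟩ * ⟨m * Q.a + n * Q.b, n⟩ + ⟨s', 0⟩ * ⟨r * Q.a + s * Q.b, s⟩ := by
    apply mul_left_cancel₀ hx
    rw [mul_add, mul_left_comm x, mul_left_comm x, ← g1, ← g2, g4, mul_left_comm, mul_left_comm _ y,
      ← mul_add]
    congr 1
    ext1 <;> simp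
  have e3r := congrArg QuadraticAlgebra.re e3
  have e3i := congrArg QuadraticAlgebra.im e3
  have e4r := congrArg QuadraticAlgebra.re e4
  have e4i := congrArg QuadraticAlgebra.im e4
  simp only [QuadraticAlgebra.re_mul, QuadraticAlgebra.im_mul, QuadraticAlgebra.re_add,
    QuadraticAlgebra.im_add, mul_zero, zero_mul, add_zero] at e3r e3i e4r e4i
  have i1 : m' * m + n' * r = 1 := by
    apply mul_left_cancel₀ ha
    linear_combination -e3r + Q.b * e3i
  have i2 : r' * m + s' * r = 0 := by
    apply mul_left_cancel₀ ha
    linear_combination -e4r + Q.b * e4i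
  have hunit : (m' * s' - n' * r') * (m * s - n * r) = 1 := by
    linear_combination (r' * n + s' * s) * i1 - (m' * n + n' * s) * i2 - e4i
  obtain ⟨d, hd0, hd⟩ : ∃ d : k, IsUnit d ∧ C d = m * s - n * r :=
    isUnit_iff.1 (IsUnit.of_mul_eq_one_right _ hunit)
  -- comparison of the two forms
  have cross : (⟨m * Q.a + n * Q.b, n⟩ : Ord D) * ⟨Q'.b, 1⟩ = ⟨r * Q.a + s * Q.b, s⟩ * ⟨Q'.a, 0⟩ := by
    apply mul_left_cancel₀ (mul_ne_zero hx hy)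
    linear_combination (x * ⟨m * Q.a + n * Q.b, n⟩) * g2 - (x * ⟨r * Q.a + s * Q.b, s⟩) * g1
  have cr := congrArg QuadraticAlgebra.re cross
  have ci := congrArg QuadraticAlgebra.im cross
  simp only [QuadraticAlgebra.re_mul, QuadraticAlgebra.im_mul, mul_zero, zero_mul, add_zero,
    mul_one] at cr ci
  have fa : Q.a * m ^ 2 + 2 * Q.b * m * n + Q.c * n ^ 2 = C d * Q'.a := by
    apply mul_left_cancel₀ ha
    rw [hd]
    linear_combination (-n ^ 2) * hq - n * cr + (m * Q.a + n * Q.b) * ci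
  have fb : Q.a * m * r + Q.b * (m * s + r * n) + Q.c * n * s = C d * Q'.b := by
    apply mul_left_cancel₀ (mul_ne_zero ha ha')
    linear_combination (n ^ 2 * Q'.b - Q'.a * n * s) * hq - (m * Q.a + n * Q.b) * cr + D * n * ci
      + Q.a * Q'.b * fa
  have fc : Q.a * r ^ 2 + 2 * Q.b * r * s + Q.c * s ^ 2 = C d * Q'.c := by
    apply mul_left_cancel₀ (mul_ne_zero (C_ne_zero.2 hd0.ne_zero) ha')
    linear_combination (-(Q.a * r ^ 2 + 2 * Q.b * r * s + Q.c * s ^ 2)) * fa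
      + (Q.a * m * r + Q.b * (m * s + r * n) + Q.c * n * s + C d * Q'.b) * fb
      - (m * s - n * r) ^ 2 * hq + C d ^ 2 * hq' + D * (C d + (m * s - n * r)) * hd
  have hpos : IsPositive (C d) := by
    refine IsPositive.of_mul (m := Q.a * Q'.a) ?_ (Q.pos.mul Q'.pos)
    have : Q.a * Q'.a * C d = (Q.a * m + Q.b * n) ^ 2 - D * n ^ 2 := by
      linear_combination (-Q.a) * fa - n ^ 2 * hq
    rw [this]
    refine isPositive_norm ?_
    rintro ⟨h1, h2⟩
    have h3 : Q.a * Q'.a * C d = 0 := by rw [this, h1, h2]; ring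
    rw [mul_eq_zero, mul_eq_zero, C_eq_zero] at h3
    rcases h3 with (h3 | h3) | h3
    exacts [ha h3, ha' h3, hd0.ne_zero h3]
  obtain ⟨c, hc, rfl⟩ := exists_sq_of_isPositive_C hpos
  have hcc : C c⁻¹ * C c = (1 : k[X]) := by rw [← C_mul, inv_mul_cancel₀ hc, C_1]
  rw [C_pow] at *
  refine Quotient.sound ⟨⟨!![C c⁻¹ * m, C c⁻¹ * r; C c⁻¹ * n, C c⁻¹ * s], ?_⟩, ?_⟩
  · rw [Matrix.det_fin_two]
    simp only [Matrix.of_apply, Matrix.cons_val', Matrix.cons_val_zero, Matrix.cons_val_one,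
      Matrix.cons_val_fin_one]
    linear_combination (-C c⁻¹ ^ 2) * hd + (C c⁻¹ * C c + 1) * hcc
  · ext1 <;> simp only [BinForm.act, Matrix.of_apply, Matrix.cons_val', Matrix.cons_val_zero, Matrix.cons_val_one,
      Matrix.cons_val_fin_one]
    · linear_combination (-C c⁻¹ ^ 2) * fa - Q'.a * (C c⁻¹ * C c + 1) * hcc
    · linear_combination (-C c⁻¹ ^ 2) * fb - Q'.b * (C c⁻¹ * C c + 1) * hcc
    · linear_combination (-C c⁻¹ ^ 2) * fc - Q'.c * (C c⁻¹ * C c + 1) * hcc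

theorem idl_of_composed {Q Q' Q'' : Form D} {a a' e f : k[X]} [CharZero k]
    (h : Q.toBinForm = ⟨a, e, a' * f⟩) (h' : Q'.toBinForm = ⟨a', e, a * f⟩)
    (h'' : Q''.toBinForm = ⟨a * a', e, f⟩) : idl Q'' = idl Q * idl Q' := by
  have q1 := Q''.bb
  have ha' : a' ≠ 0 := by have := Q'.pos.ne_zero; rwa [h'] at this
  rw [h''] at q1
  simp only at q1
  obtain ⟨α, β, γ, hbez⟩ := exists_bezout (a := a) (b := 2 * e) (c := a') ha' (by
    intro p hp h1 h2 h3
    refine not_prime_sq_dvd (D := D) hp ?_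
    rw [← q1]
    refine dvd_sub (pow_dvd_pow_of_dvd (prime_dvd_of_two_mul hp h2) 2) ?_
    rw [pow_two]
    exact (mul_dvd_mul h1 h3).mul_right _)
  apply le_antisymm
  · have mem : ∀ x ∈ ({⟨Q.a, 0⟩, ⟨Q.b, 1⟩} : Set (Ord D)), ∀ y ∈ ({⟨Q'.a, 0⟩, ⟨Q'.b, 1⟩} : Set (Ord D)),
        x * y ∈ idl Q * idl Q' := fun x hx y hy =>
      Ideal.mul_mem_mul (Ideal.subset_span hx) (Ideal.subset_span hy)
    have m1 := mem ⟨Q.a, 0⟩ (by simp) ⟨Q'.a, 0⟩ (by simp)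
    have m2 := mem ⟨Q.a, 0⟩ (by simp) ⟨Q'.b, 1⟩ (by simp)
    have m3 := mem ⟨Q.b, 1⟩ (by simp) ⟨Q'.a, 0⟩ (by simp)
    have m4 := mem ⟨Q.b, 1⟩ (by simp) ⟨Q'.b, 1⟩ (by simp)
    rw [idl, Ideal.span_le]
    rintro z (rfl | rfl)
    · rw [h'', SetLike.mem_coe]
      rw [h, h'] at m1
      convert m1 using 1
      apply QuadraticAlgebra.ext <;> simp
    · rw [h'', SetLike.mem_coe]
      rw [h] at m1 m2 m3 m4
      rw [h'] at m1 m2 m3 m4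
      have := add_mem (add_mem (Ideal.mul_mem_left _ ⟨α, 0⟩ m2) (Ideal.mul_mem_left _ ⟨γ, 0⟩ m3))
        (add_mem (Ideal.mul_mem_left _ ⟨β, 0⟩ m4) (Ideal.mul_mem_left _ ⟨β * f, 0⟩ m1))
      convert this using 1
      apply QuadraticAlgebra.ext <;> simp only [QuadraticAlgebra.re_mul, QuadraticAlgebra.im_mul,
        QuadraticAlgebra.re_add, QuadraticAlgebra.im_add]
      · linear_combination (-e) * hbez + β * q1
      · linear_combination -hbez
  · unfold idl
    rw [Ideal.span_pair_mul_span_pair, Ideal.span_le]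
    rintro z (rfl | rfl | rfl | rfl) <;> rw [SetLike.mem_coe] <;>
      refine (mem_idl (Q := Q'')).2 ?_ <;> rw [h, h', h'']
    · refine ⟨1, 0, ?_⟩
      apply QuadraticAlgebra.ext <;> simp
    · refine ⟨0, a, ?_⟩
      apply QuadraticAlgebra.ext <;> simp
    · refine ⟨0, a', ?_⟩
      apply QuadraticAlgebra.ext <;> simp [mul_comm]
    · refine ⟨-f, 2 * e, ?_⟩
      apply QuadraticAlgebra.ext <;> simp only [QuadraticAlgebra.re_mul, QuadraticAlgebra.im_mul]
      · linear_combination -q1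
      · ring

theorem idl_mul_opp [CharZero k] (Q : Form D) : idl Q * idl Q.opp = Ideal.span {⟨Q.a, 0⟩} := by
  have q1 := Q.bb
  obtain ⟨α, β, γ, hbez⟩ := exists_bezout (a := Q.c) (b := 2 * Q.b) (c := Q.a) Q.pos.ne_zero (by
    intro p hp h1 h2 h3
    refine not_prime_sq_dvd (D := D) hp ?_
    rw [← q1]
    refine dvd_sub (pow_dvd_pow_of_dvd (prime_dvd_of_two_mul hp h2) 2) ?_
    rw [pow_two]
    exact mul_dvd_mul h3 h1)
  unfold idl Form.opp
  apply le_antisymm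
  · rw [Ideal.span_pair_mul_span_pair, Ideal.span_le]
    rintro z (rfl | rfl | rfl | rfl) <;> rw [SetLike.mem_coe, Ideal.mem_span_singleton]
    · exact ⟨⟨Q.a, 0⟩, rfl⟩
    · exact ⟨⟨-Q.b, 1⟩, rfl⟩
    · exact ⟨⟨Q.b, 1⟩, mul_comm _ _⟩
    · refine ⟨⟨-Q.c, 0⟩, ?_⟩
      apply QuadraticAlgebra.ext <;> simp only [QuadraticAlgebra.re_mul, QuadraticAlgebra.im_mul]
      · linear_combination -q1
      · ring
  · rw [Ideal.span_pair_mul_span_pair, Ideal.span_singleton_le_iff_mem]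
    have sub : ∀ x ∈ ({⟨Q.a, 0⟩ * ⟨Q.a, 0⟩, ⟨Q.a, 0⟩ * ⟨-Q.b, 1⟩, ⟨Q.b, 1⟩ * ⟨Q.a, 0⟩,
        ⟨Q.b, 1⟩ * ⟨-Q.b, 1⟩} : Set (Ord D)), x ∈ Ideal.span ({⟨Q.a, 0⟩ * ⟨Q.a, 0⟩,
        ⟨Q.a, 0⟩ * ⟨-Q.b, 1⟩, ⟨Q.b, 1⟩ * ⟨Q.a, 0⟩, ⟨Q.b, 1⟩ * ⟨-Q.b, 1⟩} : Set (Ord D)) :=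
      fun x hx => Ideal.subset_span hx
    have m1 := sub _ (Or.inl rfl)
    have m2 := sub _ (Or.inr (Or.inl rfl))
    have m3 := sub _ (Or.inr (Or.inr (Or.inl rfl)))
    have m4 := sub _ (Or.inr (Or.inr (Or.inr rfl)))
    have := add_mem (add_mem (Ideal.mul_mem_left _ ⟨γ, 0⟩ m1) (Ideal.mul_mem_left _ ⟨-β, 0⟩ m2))
        (add_mem (Ideal.mul_mem_left _ ⟨β, 0⟩ m3) (Ideal.mul_mem_left _ ⟨-α, 0⟩ m4))
    convert this using 1
    apply QuadraticAlgebra.ext <;> simp only [QuadraticAlgebra.re_mul, QuadraticAlgebra.im_mul,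
        QuadraticAlgebra.re_add, QuadraticAlgebra.im_add]
    · linear_combination (-Q.a) * hbez - α * q1
    · ring

theorem idl_principal : idl (principalForm D) = ⊤ :=
  (Ideal.eq_top_iff_one _).2 (Ideal.subset_span (Or.inl rfl))

theorem cls_opp {Q Q' : Form D} (h : Q ≈ Q') : cls Q.opp = cls Q'.opp := by
  obtain ⟨M, hM⟩ : ∃ M : Matrix.SpecialLinearGroup (Fin 2) k[X],
    Q'.toBinForm = Q.toBinForm.act M := h
  have hdet := M.det_coe
  rw [Matrix.det_fin_two] at hdet
  refine Quotient.sound ⟨⟨!![M 0 0, -M 0 1; -M 1 0, M 1 1], ?_⟩, ?_⟩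
  · rw [Matrix.det_fin_two]
    simpa using hdet
  · ext1 <;> simp [Form.opp, BinForm.act, hM] <;> ring

/-! ### The class group -/

section Group

variable [CharZero k]

/-- The product of two classes is their composition. -/
instance : Mul (FormClass D) := ⟨fun C C' => Classical.choose (exists_composes C C')⟩

/-- The identity is the class of `(1, 0, -D)`. -/
instance : One (FormClass D) := ⟨cls (principalForm D)⟩

/-- The inverse of the class of `(a, b, c)` is the class of `(a, -b, c)`. -/
instance : Inv (FormClass D) := ⟨Quotient.lift (fun Q => cls Q.opp) fun _ _ => cls_opp⟩

theorem composes_mul (C C' : FormClass D) : Composes C C' (C * C') :=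
  Classical.choose_spec (exists_composes C C')

theorem idEq_of_composes {Q Q' Q'' : Form D} (h : Composes (cls Q) (cls Q') (cls Q'')) :
    IdEq (idl Q'') (idl Q * idl Q') := by
  obtain ⟨R, R', R'', a, a', e, f, h1, h2, h3, h4, h5, h6⟩ := h
  refine (idEq_of_cls_eq h6.symm).trans ?_
  rw [idl_of_composed h1 h2 h3]
  exact (idEq_of_cls_eq h4).mul (idEq_of_cls_eq h5)

theorem exists_mul_eq (Q Q' : Form D) :
    ∃ Q'' : Form D, cls Q * cls Q' = cls Q'' ∧ IdEq (idl Q'') (idl Q * idl Q') := by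
  obtain ⟨Q'', h⟩ := Quotient.exists_rep (cls Q * cls Q')
  refine ⟨Q'', h.symm, idEq_of_composes ?_⟩
  have := composes_mul (cls Q) (cls Q')
  rwa [← h] at this

/-- The composition of two classes is uniquely determined. -/
theorem composes_iff {C C' C'' : FormClass D} : Composes C C' C'' ↔ C * C' = C'' := by
  refine ⟨fun h => ?_, fun h => h ▸ composes_mul C C'⟩
  induction C using Quotient.inductionOn with | _ Q
  induction C' using Quotient.inductionOn with | _ Q'
  induction C'' using Quotient.inductionOn with | _ Q''
  obtain ⟨R, hR, hI⟩ := exists_mul_eq Q Q'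
  exact hR.trans (cls_eq_of_idEq (hI.trans (idEq_of_composes h).symm))

/-- The class group `𝒞_D`. -/
instance : CommGroup (FormClass D) where
  mul_assoc C C' C'' := by
    induction C using Quotient.inductionOn with | _ Q
    induction C' using Quotient.inductionOn with | _ Q'
    induction C'' using Quotient.inductionOn with | _ Q''
    change cls Q * cls Q' * cls Q'' = cls Q * (cls Q' * cls Q'')
    obtain ⟨R, h1, i1⟩ := exists_mul_eq Q Q'
    obtain ⟨S, h2, i2⟩ := exists_mul_eq R Q''
    obtain ⟨R', h3, i3⟩ := exists_mul_eq Q' Q''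
    obtain ⟨S', h4, i4⟩ := exists_mul_eq Q R'
    rw [h1, h2, h3, h4]
    refine cls_eq_of_idEq (i2.trans ((i1.mul (.of_eq rfl)).trans (.trans ?_ i4.symm)))
    rw [mul_assoc]
    exact (IdEq.of_eq rfl).mul i3.symm
  mul_comm C C' := by
    induction C using Quotient.inductionOn with | _ Q
    induction C' using Quotient.inductionOn with | _ Q'
    change cls Q * cls Q' = cls Q' * cls Q
    obtain ⟨R, h1, i1⟩ := exists_mul_eq Q Q'
    obtain ⟨S, h2, i2⟩ := exists_mul_eq Q' Q
    rw [h1, h2]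
    rw [mul_comm] at i1
    exact cls_eq_of_idEq (i1.trans i2.symm)
  one_mul C := by
    induction C using Quotient.inductionOn with | _ Q
    obtain ⟨R, h1, i1⟩ := exists_mul_eq (principalForm D) Q
    rw [idl_principal, Ideal.top_mul] at i1
    exact h1.trans (cls_eq_of_idEq i1)
  mul_one C := by
    induction C using Quotient.inductionOn with | _ Q
    obtain ⟨R, h1, i1⟩ := exists_mul_eq Q (principalForm D)
    rw [idl_principal, Ideal.mul_top] at i1
    exact h1.trans (cls_eq_of_idEq i1)
  inv_mul_cancel C := by
    induction C using Quotient.inductionOn with | _ Q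
    obtain ⟨R, h1, i1⟩ := exists_mul_eq Q.opp Q
    refine h1.trans (cls_eq_of_idEq (i1.trans ?_))
    rw [mul_comm, idl_mul_opp, idl_principal]
    refine ⟨1, ⟨Q.a, 0⟩, one_ne_zero, fun h => Q.pos.ne_zero (congrArg QuadraticAlgebra.re h), ?_⟩
    simp

end Group

end Classes

/-! ### Symbols -/

section Symbols

variable {k : Type*} [Field k]

/-- `F^• / F^{•2}`. -/
abbrev SquareClasses (F : Type*) [CommRing F] : Type _ := Fˣ ⧸ Subgroup.square Fˣ

/-- The part of `a ≠ 0` prime to `p`: the `u` with `a = p^{v_p(a)} u`. -/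
def unitPart (p a : k[X]) : k[X] := a / p ^ multiplicity p a

open Classical in
/-- The class in `F_p^•`, `F_p = k[t]/(p)`, of a polynomial `u` prime to `p`. -/
def residue (p u : k[X]) : (AdjoinRoot p)ˣ :=
  if h : IsUnit (AdjoinRoot.mk p u) then h.unit else 1

/-- The valuation `v_p` on `k(t)^•`. -/
def ratVal (p : k[X]) (x : RatFunc k) : ℤ := multiplicity p x.num - multiplicity p x.denom

/-- The class in `F_p^•` of the `u` with `x = p^{v_p(x)} u`, for `x ∈ k(t)^•`. -/
def ratRes (p : k[X]) (x : RatFunc k) : (AdjoinRoot p)ˣ :=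
  residue p (unitPart p x.num) / residue p (unitPart p x.denom)

/-- The symbol `(x, y)_p = (-1)^{v(x) v(y)} x^{v(y)} y^{v(x)}` for `p` irreducible and
`x, y ∈ k(t)^•`. Modulo squares, `x` and `y` are replaced here by their parts prime to `p`: this
removes the factor `p^{2 v(x) v(y)}`. -/
def symbol (p : k[X]) (x y : RatFunc k) : SquareClasses (AdjoinRoot p) :=
  QuotientGroup.mk ((-1) ^ (ratVal p x * ratVal p y) * ratRes p x ^ ratVal p y *
    ratRes p y ^ ratVal p x)

theorem isUnit_mk {p u : k[X]} (h : IsCoprime u p) : IsUnit (AdjoinRoot.mk p u) := by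
  obtain ⟨x, y, hxy⟩ := h
  refine IsUnit.of_mul_eq_one_right (AdjoinRoot.mk p x) ?_
  rw [← map_mul, ← map_one (AdjoinRoot.mk p), ← hxy]
  simp

theorem coe_residue {p u : k[X]} (h : IsCoprime u p) :
    (residue p u : AdjoinRoot p) = AdjoinRoot.mk p u := by
  rw [residue, dif_pos (isUnit_mk h), IsUnit.unit_spec]

theorem residue_mul {p u v : k[X]} (hu : IsCoprime u p) (hv : IsCoprime v p) :
    residue p (u * v) = residue p u * residue p v := by
  ext
  rw [Units.val_mul, coe_residue hu, coe_residue hv, coe_residue (hu.mul_left hv), map_mul]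

theorem residue_one (p : k[X]) : residue p 1 = 1 := by
  ext
  rw [coe_residue isCoprime_one_left, map_one, Units.val_one]

theorem not_dvd_of_isCoprime {p n : k[X]} (hp : Irreducible p) (h : IsCoprime n p) : ¬ p ∣ n :=
  fun hd => hp.not_isUnit (h.symm.isUnit_of_dvd' dvd_rfl hd)

theorem symbol_eq {p n D : k[X]} (hp : Irreducible p) (hn : IsCoprime n p) :
    symbol p (algebraMap k[X] (RatFunc k) n) (algebraMap k[X] (RatFunc k) D) =
      QuotientGroup.mk (residue p n) ^ multiplicity p D := by
  have h0 : multiplicity p n = 0 := multiplicity_eq_zero.2 (not_dvd_of_isCoprime hp hn)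
  have h1 : multiplicity p (1 : k[X]) = 0 :=
    multiplicity_eq_zero.2 (not_dvd_of_isCoprime hp isCoprime_one_left)
  simp [symbol, ratVal, ratRes, unitPart, h0, h1, residue_one]

theorem sq_eq_one {F : Type*} [CommRing F] (x : Fˣ) :
    (QuotientGroup.mk (x * x) : SquareClasses F) = 1 :=
  (QuotientGroup.eq_one_iff _).2 ⟨x, rfl⟩

theorem sc_mul_self {F : Type*} [CommRing F] (x : SquareClasses F) : x * x = 1 := by
  induction x using QuotientGroup.induction_on with | H x
  exact sq_eq_one x

end Symbols

/-! ### Genus characters -/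

section Genus

variable {k : Type*} [Field k] {D : k[X]}

theorem BinForm.eval_mul_eval (Q : BinForm k) (x y x' y' : k[X]) :
    Q.eval x y * Q.eval x' y' = (Q.a * x * x' + Q.b * (x * y' + x' * y) + Q.c * y * y') ^ 2 -
      Q.disc * (x * y' - x' * y) ^ 2 := by
  unfold BinForm.eval BinForm.disc; ring

theorem symbol_eq_of_represents {p : k[X]} (hp : Irreducible p) (Q : Form D) {n n' : k[X]}
    (hn : IsCoprime n p) (hn' : IsCoprime n' p) (h : Q.ProperlyRepresents n)
    (h' : Q.ProperlyRepresents n') :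
    symbol p (algebraMap k[X] (RatFunc k) n) (algebraMap k[X] (RatFunc k) D) =
      symbol p (algebraMap k[X] (RatFunc k) n') (algebraMap k[X] (RatFunc k) D) := by
  rw [symbol_eq hp hn, symbol_eq hp hn']
  by_cases hpD : p ∣ D
  · congr 1
    obtain ⟨x, y, -, rfl⟩ := h
    obtain ⟨x', y', -, rfl⟩ := h'
    have key := Q.eval_mul_eval x y x' y'
    rw [Q.disc_eq] at key
    set Z := Q.a * x * x' + Q.b * (x * y' + x' * y) + Q.c * y * y'
    have hZ : AdjoinRoot.mk p (Q.eval x y * Q.eval x' y') = AdjoinRoot.mk p Z * AdjoinRoot.mk p Z := by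
      rw [key, map_sub, map_mul, AdjoinRoot.mk_eq_zero.2 hpD, zero_mul, sub_zero, map_pow, pow_two]
    have hu : IsUnit (AdjoinRoot.mk p Z) :=
      isUnit_of_mul_isUnit_left (hZ ▸ isUnit_mk (hn.mul_left hn'))
    have h2 : residue p (Q.eval x y) * residue p (Q.eval x' y') = hu.unit * hu.unit := by
      ext
      rw [← residue_mul hn hn', coe_residue (hn.mul_left hn'), hZ, Units.val_mul, IsUnit.unit_spec]
    have h3 := sq_eq_one hu.unit
    rw [← h2, QuotientGroup.mk_mul] at h3
    exact mul_right_cancel (h3.trans (sc_mul_self _).symm)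
  · rw [multiplicity_eq_zero.2 hpD, pow_zero, pow_zero]

theorem represents_of_equiv {Q Q' : Form D} (h : Q ≈ Q') {n : k[X]}
    (hn : Q'.ProperlyRepresents n) : Q.ProperlyRepresents n := by
  obtain ⟨M, hM⟩ : ∃ M : Matrix.SpecialLinearGroup (Fin 2) k[X],
    Q'.toBinForm = Q.toBinForm.act M := h
  have hdet := M.det_coe
  rw [Matrix.det_fin_two] at hdet
  obtain ⟨x, y, ⟨u, v, huv⟩, rfl⟩ := hn
  refine ⟨M 0 0 * x + M 0 1 * y, M 1 0 * x + M 1 1 * y,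
    ⟨u * M 1 1 - v * M 1 0, v * M 0 0 - u * M 0 1, ?_⟩, ?_⟩
  · linear_combination (u * x + v * y) * hdet + huv
  · rw [hM]
    unfold BinForm.eval BinForm.act
    ring

theorem represents_a (Q : Form D) : Q.ProperlyRepresents Q.a :=
  ⟨1, 0, isCoprime_one_left, by simp [BinForm.eval]⟩

variable [hD : NegSqfreeOdd D] [CharZero k]

theorem exists_represented (Q : Form D) {p : k[X]} (hp : Irreducible p) :
    ∃ n : k[X], IsCoprime n p ∧ Q.ProperlyRepresents n := by
  obtain ⟨Q', h, hc⟩ := exists_rep Q hp.ne_zero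
  exact ⟨Q'.a, hc, represents_of_equiv (Quotient.exact h.symm) (represents_a Q')⟩

/-- `χ_p(Q) = (n, D)_p` for any `n` prime to `p` that is properly represented by `Q`. -/
def genusValue (Q : Form D) {p : k[X]} (hp : Irreducible p) : SquareClasses (AdjoinRoot p) :=
  symbol p (algebraMap k[X] (RatFunc k) (Classical.choose (exists_represented Q hp)))
    (algebraMap k[X] (RatFunc k) D)

theorem genusValue_eq (Q : Form D) {p : k[X]} (hp : Irreducible p) {n : k[X]}
    (hn : IsCoprime n p) (h : Q.ProperlyRepresents n) :
    genusValue Q hp =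
      symbol p (algebraMap k[X] (RatFunc k) n) (algebraMap k[X] (RatFunc k) D) :=
  have hs := Classical.choose_spec (exists_represented Q hp)
  symbol_eq_of_represents hp Q hs.1 hn hs.2 h

/-- The genus character `χ_p : 𝒞_D → F_p^• / F_p^{•2}`. -/
def genusChar (D : k[X]) [NegSqfreeOdd D] {p : k[X]} (hp : Irreducible p) :
    FormClass D →* SquareClasses (AdjoinRoot p) :=
  MonoidHom.mk' (Quotient.lift (fun Q => genusValue Q hp) fun Q Q' h => by
    obtain ⟨n, hn, hr⟩ := exists_represented Q' hp
    exact (genusValue_eq Q hp hn (represents_of_equiv h hr)).trans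
      (genusValue_eq Q' hp hn hr).symm) (by
    intro C C'
    obtain ⟨Q, Q', Q'', a, a', e, g, h1, h2, h3, rfl, rfl, h6, h7⟩ :=
      exists_composes_coprime C C' hp.ne_zero
    rw [composes_iff.1 ⟨Q, Q', Q'', a, a', e, g, h1, h2, h3, rfl, rfl, rfl⟩]
    have r1 := represents_a Q
    have r2 := represents_a Q'
    have r3 := represents_a Q''
    have e1 : Q.a = a := by rw [h1]
    have e2 : Q'.a = a' := by rw [h2]
    have e3 : Q''.a = a * a' := by rw [h3]
    rw [e1] at r1
    rw [e2] at r2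
    rw [e3] at r3
    change genusValue Q'' hp = genusValue Q hp * genusValue Q' hp
    rw [genusValue_eq Q hp h6 r1, genusValue_eq Q' hp h7 r2, genusValue_eq Q'' hp (h6.mul_left h7) r3,
      symbol_eq hp h6, symbol_eq hp h7, symbol_eq hp (h6.mul_left h7), residue_mul h6 h7,
      QuotientGroup.mk_mul, mul_pow])

/-- The principal genus: the intersection of the kernels of `χ_p` over the primes (monic
irreducible polynomials) `p ∣ D`. -/
def principalGenus (D : k[X]) [NegSqfreeOdd D] : Subgroup (FormClass D) :=
  ⨅ (p : k[X]) (hp : p.Monic ∧ Irreducible p ∧ p ∣ D), (genusChar D hp.2.1).ker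

/-- The group of genera `𝒢_D`: the cosets of the principal genus. -/
abbrev GenusGroup (D : k[X]) [NegSqfreeOdd D] : Type _ := FormClass D ⧸ principalGenus D

end Genus


end

end PolyQuad

open Polynomial

namespace PolyQuad

/-! ### Congruences: squares modulo a square-free polynomial, and small solutions -/

section SquareValues

variable {k : Type*} [Field k] {D : k[X]}

/-! Squares lie in the principal genus because the characters take values in groups of exponent 2.
The content is the converse, and it rests on showing that a form in the principal genus represents a
nonzero square.

Represent the class by Q = (a, b, c) with a prime to D. Since D is square-free, χ_p = 1 says that a
is a square modulo p for each p ∣ D, and by the Chinese remainder theorem a ≡ s² modulo D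
(`exists_dvd_sub_sq`). It remains to solve x² - Dy² = az² with x ≡ by modulo a. The congruences x ≡
by (mod a) and x ≡ sz (mod D) already force aD ∣ x² - Dy² - az². Linear algebra over k gives a
nonzero solution of these congruences with degrees so small that the multiple of aD must vanish
(`exists_dvd_sub_of_finrank_lt`). This is the polynomial form of the geometry-of-numbers proof of
Legendre's theorem, and the odd degree of D makes the count come out exactly. Writing x = by + aX
gives Q(X, y) = z², with z ≠ 0 because the norm form x² - Dy² is anisotropic
(`Form.exists_eval_eq_sq`).

After removal of the common factor of X and y and a rescaling by a constant, Q properly represents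
w² with w ≻ 0 (`Form.exists_properlyRepresents_sq`). Hence Q is equivalent to some (w², e, f), which
is the composite of (w, e, wf) with itself (`isSquare_cls_of_represents_sq`). -/

/-- A polynomial that is a square modulo every prime factor of a squarefree `E` is a square
modulo `E`. -/
theorem exists_dvd_sub_sq (a : k[X]) (E : k[X]) (hE : Squarefree E)
    (h : ∀ p, Irreducible p → p ∣ E → ∃ s, p ∣ a - s ^ 2) : ∃ s, E ∣ a - s ^ 2 := by
  induction E using WfDvdMonoid.induction_on_irreducible with
  | zero => exact absurd hE not_squarefree_zero
  | unit u hu => exact ⟨0, hu.dvd⟩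
  | mul E i hE0 hi ih =>
    obtain ⟨s, hs⟩ := ih hE.of_mul_right fun p hp hpE => h p hp (hpE.mul_left i)
    obtain ⟨r, hr⟩ := h i hi (dvd_mul_right i E)
    have hndvd : ¬ i ∣ E := fun hd => hi.not_isUnit (hE i (mul_dvd_mul_left i hd))
    have hcop : IsCoprime i E := (hi.coprime_iff_not_dvd).2 hndvd
    have ⟨u, v, huv⟩ := hcop
    -- Chinese remainder theorem: since ui + vE = 1, this element is r modulo i and s modulo E.
    -- Coprimality of i and E comes from square-freeness of iE.
    refine ⟨s * (u * i) + r * (v * E), hcop.mul_dvd ?_ ?_⟩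
    · obtain ⟨w, hw⟩ := hr
      exact ⟨w + (r + s * (u * i) + r * (v * E)) * (r * u - s * u), by
        linear_combination hw - r * (r + s * (u * i) + r * (v * E)) * huv⟩
    · obtain ⟨w, hw⟩ := hs
      exact ⟨w + (s + s * (u * i) + r * (v * E)) * (s * v - r * v), by
        linear_combination hw - s * (s + s * (u * i) + r * (v * E)) * huv⟩

/-- Pigeonhole by dimension: the triples (x, y, z) with the given degree bounds form a k-space of
dimension l + m + n, while the two congruences are the kernel of a linear map to k[t]/(a) ×
k[t]/(d), of dimension deg a + deg d. This plays the role of Minkowski's or Thue's lemma. -/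
theorem exists_dvd_sub_of_finrank_lt {a d : k[X]} (ha : a ≠ 0) (hd : d ≠ 0) (b s : k[X])
    {l m n : ℕ} (h : a.natDegree + d.natDegree < l + m + n) :
    ∃ x ∈ degreeLT k l, ∃ y ∈ degreeLT k m, ∃ z ∈ degreeLT k n,
      ¬ (x = 0 ∧ y = 0 ∧ z = 0) ∧ a ∣ x - b * y ∧ d ∣ x - s * z := by
  have := (AdjoinRoot.powerBasis ha).finite
  have := (AdjoinRoot.powerBasis hd).finite
  -- `X`, `Y`, `Z` are the coordinates of a triple, regarded as polynomials; `f` sends a triple to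
  -- the residues of x - by and x - sz.
  let X := (degreeLT k l).subtype ∘ₗ LinearMap.fst k (degreeLT k l) (degreeLT k m × degreeLT k n)
  let Y := (degreeLT k m).subtype ∘ₗ LinearMap.fst k _ (degreeLT k n) ∘ₗ
    LinearMap.snd k (degreeLT k l) (degreeLT k m × degreeLT k n)
  let Z := (degreeLT k n).subtype ∘ₗ LinearMap.snd k (degreeLT k m) _ ∘ₗ
    LinearMap.snd k (degreeLT k l) (degreeLT k m × degreeLT k n)
  let f := ((AdjoinRoot.mkₐ a).toLinearMap ∘ₗ (X - LinearMap.mulLeft k b ∘ₗ Y)).prod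
    ((AdjoinRoot.mkₐ d).toLinearMap ∘ₗ (X - LinearMap.mulLeft k s ∘ₗ Z))
  have hrank (N : ℕ) : Module.finrank k (degreeLT k N) = N := by
    rw [(degreeLTEquiv k N).finrank_eq, Module.finrank_fin_fun]
  have (N : ℕ) : Module.Finite k (degreeLT k N) := .equiv (degreeLTEquiv k N).symm
  have hlt : Module.finrank k (AdjoinRoot a × AdjoinRoot d) <
      Module.finrank k (degreeLT k l × degreeLT k m × degreeLT k n) := by
    simp only [Module.finrank_prod, hrank, (AdjoinRoot.powerBasis ha).finrank,
      (AdjoinRoot.powerBasis hd).finrank, AdjoinRoot.powerBasis_dim]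
    omega
  obtain ⟨⟨x, y, z⟩, hv, hv0⟩ := (Submodule.ne_bot_iff _).1 (f.ker_ne_bot_of_finrank_lt hlt)
  rw [LinearMap.mem_ker] at hv
  have h1 : AdjoinRoot.mk a (x - b * y) = 0 := congrArg Prod.fst hv
  have h2 : AdjoinRoot.mk d (x - s * z) = 0 := congrArg Prod.snd hv
  refine ⟨x, x.2, y, y.2, z, z.2, ?_, AdjoinRoot.mk_eq_zero.1 h1, AdjoinRoot.mk_eq_zero.1 h2⟩
  rintro ⟨hx, hy, hz⟩
  exact hv0 (Prod.ext (Subtype.ext hx) (Prod.ext (Subtype.ext hy) (Subtype.ext hz)))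

/-- For x ≠ 0 the degree is at most deg w + 2(n - 1); the hypothesis is this bound freed of
subtraction. The case x = 0, which includes n = 0, holds because `degree` is then ⊥. -/
theorem degree_mul_sq_lt {w x : k[X]} {n N : ℕ} (hx : x ∈ degreeLT k n)
    (h : w.natDegree + 2 * n < N + 2) : (w * x ^ 2).degree < N := by
  by_cases hx0 : x = 0
  · simp [hx0]
  have h1 := (natDegree_lt_iff_degree_lt hx0).2 (mem_degreeLT.1 hx)
  refine degree_le_natDegree.trans_lt (Nat.cast_lt.2 ?_)
  have := natDegree_mul_le (p := w) (q := x ^ 2)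
  rw [natDegree_pow] at this
  omega

/-! ### Forms that represent squares -/

/-- A form representing a nonzero square properly represents the square of a positive polynomial. -/
theorem Form.exists_properlyRepresents_sq (Q : Form D) {x y z : k[X]} (hz : z ≠ 0)
    (h : Q.eval x y = z ^ 2) : ∃ w, IsPositive w ∧ Q.ProperlyRepresents (w ^ 2) := by
  classical
  have hxy : ¬ (x = 0 ∧ y = 0) := by
    rintro ⟨rfl, rfl⟩
    exact pow_ne_zero 2 hz (by rw [← h]; simp [BinForm.eval])
  have hg : EuclideanDomain.gcd x y ≠ 0 := fun h0 => hxy (EuclideanDomain.gcd_eq_zero_iff.1 h0)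
  obtain ⟨x', hx'⟩ := EuclideanDomain.gcd_dvd_left x y
  obtain ⟨y', hy'⟩ := EuclideanDomain.gcd_dvd_right x y
  have hbez := EuclideanDomain.gcd_eq_gcd_ab x y
  generalize EuclideanDomain.gcdA x y = u at hbez
  generalize EuclideanDomain.gcdB x y = v at hbez
  generalize EuclideanDomain.gcd x y = g at *
  subst hx' hy'
  have hcop : IsCoprime x' y' := ⟨u, v, mul_left_cancel₀ hg (by linear_combination -hbez)⟩
  have hev : g ^ 2 * Q.eval x' y' = z ^ 2 := by rw [← h]; unfold BinForm.eval; ring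
  -- From g² ∣ z² to g ∣ z, as k[t] is integrally closed.
  obtain ⟨w, rfl⟩ : g ∣ z := (IsIntegrallyClosed.pow_dvd_pow_iff two_ne_zero).1 ⟨_, hev.symm⟩
  have hw : w ≠ 0 := right_ne_zero_of_mul hz
  have hev' : Q.eval x' y' = w ^ 2 :=
    mul_left_cancel₀ (pow_ne_zero 2 hg) (by linear_combination hev)
  -- Scaling the vector by l replaces w by lw, whose signed leading coefficient is l · l. Thus lw ≻
  -- 0 whatever the sign of w.
  set l : k := (-1) ^ w.natDegree * w.leadingCoeff
  have hl : l ≠ 0 := mul_ne_zero (pow_ne_zero _ (by simp)) (leadingCoeff_ne_zero.2 hw)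
  have hlu : IsUnit (C l) := isUnit_C.2 hl.isUnit
  refine ⟨C l * w, isPositive_iff.2 ⟨l, hl, ?_⟩, C l * x', C l * y', ?_, ?_⟩
  · rw [natDegree_C_mul hl, leadingCoeff_mul, leadingCoeff_C, mul_left_comm, pow_two]
  · exact (isCoprime_mul_unit_left hlu x' y').2 hcop
  · rw [mul_pow, ← hev']
    unfold BinForm.eval
    ring

variable [hD : NegSqfreeOdd D]

/-- A form whose first coefficient is prime to `D` and a square modulo `D` represents a nonzero
square. -/
theorem Form.exists_eval_eq_sq (Q : Form D) (hcop : IsCoprime Q.a D) {s : k[X]}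
    (hs : D ∣ Q.a - s ^ 2) : ∃ x y z : k[X], z ≠ 0 ∧ Q.eval x y = z ^ 2 := by
  have ha := Q.pos.ne_zero
  have hodd := hD.odd
  -- Each bound is the largest for which x², Dy² and az² stay of degree below deg a + deg D. As deg
  -- D is odd, the three bounds add up to deg a + deg D + 1 for either parity of deg a, just enough
  -- for a nonzero solution.
  obtain ⟨x, hx, y, hy, z, hz, hne, ⟨X, hX⟩, hxz⟩ :=
    exists_dvd_sub_of_finrank_lt ha (disc_ne_zero D) Q.b s
      (l := (Q.a.natDegree + D.natDegree + 1) / 2) (m := (Q.a.natDegree + 1) / 2)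
      (n := (D.natDegree + 1) / 2) (by obtain ⟨r, hr⟩ := hodd; omega)
  -- Modulo a, x² - Dy² ≡ (b² - D)y² = acy² ≡ 0; modulo D, x² ≡ s²z² ≡ az².
  have hdvd : Q.a * D ∣ x ^ 2 - D * y ^ 2 - Q.a * z ^ 2 := by
    refine hcop.mul_dvd ⟨X * (x + Q.b * y) + Q.c * y ^ 2 - z ^ 2, ?_⟩ ?_
    · linear_combination (x + Q.b * y) * hX + y ^ 2 * Q.bb
    · obtain ⟨u, hu⟩ := hs
      obtain ⟨v, hv⟩ := hxz
      exact ⟨v * (x + s * z) - y ^ 2 - u * z ^ 2, by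
        linear_combination (x + s * z) * hv - z ^ 2 * hu⟩
  have hzero : x ^ 2 - D * y ^ 2 - Q.a * z ^ 2 = 0 := by
    refine eq_zero_of_dvd_of_degree_lt hdvd ?_
    rw [degree_eq_natDegree (mul_ne_zero ha (disc_ne_zero D)),
      natDegree_mul ha (disc_ne_zero D), sub_eq_add_neg, sub_eq_add_neg]
    have h1 := degree_mul_sq_lt (w := 1) (N := Q.a.natDegree + D.natDegree) hx
      (by rw [natDegree_one]; omega)
    have h2 := degree_mul_sq_lt (w := D) (N := Q.a.natDegree + D.natDegree) hy (by omega)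
    have h3 := degree_mul_sq_lt (w := Q.a) (N := Q.a.natDegree + D.natDegree) hz (by omega)
    rw [one_mul] at h1
    rw [← degree_neg] at h2 h3
    exact (degree_add_le _ _).trans_lt
      (max_lt ((degree_add_le _ _).trans_lt (max_lt h1 h2)) h3)
  refine ⟨X, y, z, ?_, ?_⟩
  -- If z = 0, then x² - Dy² = 0, and anisotropy of the norm form kills x and y too.
  · rintro rfl
    by_cases hxy : x = 0 ∧ y = 0
    · exact hne ⟨hxy.1, hxy.2, rfl⟩
    · exact (isPositive_norm (D := D) hxy).ne_zero (by linear_combination hzero)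
  · apply mul_left_cancel₀ ha
    rw [BinForm.a_mul_eval, Q.disc_eq]
    linear_combination hzero - (Q.a * X + Q.b * y + x) * hX

/-! ### Squares in the class group and the principal genus -/

/-- A Bézout relation completes the coprime pair (x, y) to a matrix of determinant 1 having it as
first column. -/
theorem Form.exists_cls_eq_of_represents (Q : Form D) {n : k[X]} (h : Q.ProperlyRepresents n) :
    ∃ Q' : Form D, cls Q' = cls Q ∧ Q'.a = n := by
  obtain ⟨x, y, ⟨u, v, huv⟩, rfl⟩ := h
  let M : Matrix.SpecialLinearGroup (Fin 2) k[X] :=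
    ⟨!![x, -v; y, u], by rw [Matrix.det_fin_two]; simp; linear_combination huv⟩
  exact ⟨Q.act M, cls_act Q M, rfl⟩

variable [CharZero k]

/-- The class of a form properly representing the square of a positive polynomial is a square. -/
theorem isSquare_cls_of_represents_sq (Q : Form D) {w : k[X]} (hw : IsPositive w)
    (h : Q.ProperlyRepresents (w ^ 2)) : IsSquare (cls Q) := by
  obtain ⟨P, hP, hPa⟩ := Q.exists_cls_eq_of_represents h
  -- The composition square root: (w, b, wc) composed with itself is (w², b, c). The condition w ≻ 0
  -- is what places it in 𝒬_D.
  let R : Form D :=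
    { toBinForm := ⟨w, P.b, w * P.c⟩
      disc_eq := by
        unfold BinForm.disc
        linear_combination P.bb + P.c * hPa
      pos := hw }
  refine ⟨cls R, (composes_iff.1 ⟨R, R, P, w, w, P.b, P.c, rfl, rfl, ?_, rfl, rfl, hP⟩).symm⟩
  ext1
  · rw [hPa, pow_two]
  · rfl
  · rfl

/-- Since a is a represented value prime to p and v_p(D) = 1 by square-freeness, the symbol (a, D)_p
is just the square class of a modulo p. -/
theorem exists_dvd_sub_sq_of_genusChar_eq_one (Q : Form D) (hcop : IsCoprime Q.a D) {p : k[X]}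
    (hp : Irreducible p) (hpD : p ∣ D) (h : genusChar D hp (cls Q) = 1) :
    ∃ s, p ∣ Q.a - s ^ 2 := by
  have hap : IsCoprime Q.a p := hcop.of_isCoprime_of_dvd_right hpD
  have hmult : multiplicity p D = 1 := by
    refine multiplicity_eq_of_dvd_of_not_dvd (by rwa [pow_one]) ?_
    exact fun h2 => not_prime_sq_dvd (D := D) hp.prime h2
  change genusValue Q hp = 1 at h
  rw [genusValue_eq Q hp hap (represents_a Q), symbol_eq hp hap, hmult, pow_one] at h
  obtain ⟨r, hr⟩ := (QuotientGroup.eq_one_iff _).1 h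
  obtain ⟨s, hs⟩ := AdjoinRoot.mk_surjective (r : AdjoinRoot p)
  refine ⟨s, AdjoinRoot.mk_eq_zero.1 ?_⟩
  rw [map_sub, map_pow, hs, ← coe_residue hap, hr, Units.val_mul, pow_two, sub_self]

/-- The principal genus consists of the squares. -/
theorem principalGenus_eq_square : principalGenus D = Subgroup.square (FormClass D) := by
  ext C
  simp only [principalGenus, Subgroup.mem_iInf, MonoidHom.mem_ker, Subgroup.mem_square]
  constructor
  · intro h
    induction C using Quotient.inductionOn with | _ Q₀
    -- With a prime to all of D, this one value computes every χ_p at once.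
    obtain ⟨Q, hQ, hcop⟩ := exists_rep Q₀ (disc_ne_zero D)
    change ∀ p hp, genusChar D _ (cls Q₀) = 1 at h
    change IsSquare (cls Q₀)
    rw [← hQ] at h ⊢
    obtain ⟨s, hs⟩ := exists_dvd_sub_sq Q.a D hD.sqfree fun p hp hpD => by
      classical
      -- The principal genus involves only monic p, so p is replaced by its monic associate, which
      -- divides the same polynomials.
      have hn := normalize_associated p
      obtain ⟨s, hs⟩ := exists_dvd_sub_sq_of_genusChar_eq_one Q hcop (hn.symm.irreducible hp)
        (hn.dvd.trans hpD) (h _ ⟨monic_normalize hp.ne_zero, hn.symm.irreducible hp,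
          hn.dvd.trans hpD⟩)
      exact ⟨s, hn.symm.dvd.trans hs⟩
    obtain ⟨x, y, z, hz, hxyz⟩ := Q.exists_eval_eq_sq hcop hs
    obtain ⟨w, hw, hr⟩ := Q.exists_properlyRepresents_sq hz hxyz
    exact isSquare_cls_of_represents_sq Q hw hr
  · rintro ⟨B, rfl⟩ p hp
    -- Square classes have exponent 2, so every character kills B · B.
    rw [map_mul, sc_mul_self]

end SquareValues

end PolyQuad

theorem mainTheorem5 {k : Type*} [Field k] [NumberField k] (D : k[X])
    [PolyQuad.NegSqfreeOdd D] :
    PolyQuad.principalGenus D = Subgroup.square (PolyQuad.FormClass D) ∧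
      ∃ φ : PolyQuad.GenusGroup D ≃*
          PolyQuad.FormClass D ⧸ Subgroup.square (PolyQuad.FormClass D),
        ∀ C : PolyQuad.FormClass D, φ (QuotientGroup.mk C) = QuotientGroup.mk C :=
  ⟨PolyQuad.principalGenus_eq_square,
    QuotientGroup.quotientMulEquivOfEq PolyQuad.principalGenus_eq_square, fun _ => rfl⟩
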